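/- For a prime $p$, let $\mathbf{H}_p=\mathbf{G}_p*\mathbf{Ab}_{p-1}$ be the class of all finite groups $G$ having a normal $p$-subgroup $N$ such that $G/N$ is abelian of exponent dividing $p-1$. The pro-$\mathbf{H}_p$ topology on a free group $F$ is the topology having as a basis all cosets $Kx$, where $x\in F$ and $K$ is a normal subgroup of $F$ with $F/K\in\mathbf{H}_p$; a subgroup $H\le F$ is called $\mathbf{H}_p$-dense if its closure in this topology is $F$. It is decidable whether a finitely generated subgroup $H$ of a free group $F$ of finite rank is $\mathbf{H}_p$-dense. That is, there is an algorithm (a total computable function) which, given a prime $p$, a natural number $n$ and a finite list of words $w_1,\dots,w_k$ over the letters $a_1^{\pm1},\dots,a_n^{\pm1}$, decides whether the subgroup $H=\langle w_1,\dots,w_k\rangle$ of the free group $F=F(a_1,\dots,a_n)$ is $\mathbf{H}_p$-dense in $F$. -/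

import Mathlib

universe u

namespace ProV

/-- A class of groups, given by its membership predicate. -/
abbrev GroupClass : Type (u + 1) := ∀ (G : Type u) [Group G], Prop

/-- The class `G_p` of all finite `p`-groups. -/
def finPGroups (p : ℕ) : GroupClass.{u} :=
  fun G _ => Finite G ∧ IsPGroup p G

/-- The class `Ab_d` of all finite abelian groups of exponent dividing `d`. -/
def finAbelian (d : ℕ) : GroupClass.{u} :=
  fun G _ => Finite G ∧ (∀ x y : G, x * y = y * x) ∧ ∀ x : G, x ^ d = 1

/-- The product `U * V`: all groups `G` with a normal subgroup `N` in `U` such that `G ⧸ N` is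
in `V`. -/
def product (U V : GroupClass.{u}) : GroupClass.{u} :=
  fun G _ => ∃ (N : Subgroup G) (_ : N.Normal), U N ∧ V (G ⧸ N)

/-- The class `H_p = G_p * Ab_{p-1}`. -/
def classH (p : ℕ) : GroupClass.{u} :=
  product (finPGroups p) (finAbelian (p - 1))

/-- The pro-`V` topology on a group `F`, generated by the cosets `Kx` of the normal subgroups `K`
of `F` such that `F ⧸ K` is in `V`. -/
@[reducible] def proTopology (V : GroupClass.{u}) (F : Type u) [Group F] : TopologicalSpace F :=
  TopologicalSpace.generateFrom
    {S | ∃ (K : Subgroup F) (_ : K.Normal) (x : F),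
      V (F ⧸ K) ∧ S = (fun k => k * x) '' (K : Set F)}

/-- The `V`-closure of a subset: its closure in the pro-`V` topology. -/
def closureIn (V : GroupClass.{u}) {F : Type u} [Group F] (S : Set F) : Set F :=
  @closure F (proTopology V F) S

/-- A subset is `V`-dense if its `V`-closure is the whole group. -/
def IsDenseIn (V : GroupClass.{u}) {F : Type u} [Group F] (S : Set F) : Prop :=
  closureIn V S = Set.univ

/-- The subgroup of the free group on `n` letters generated by a finite list of words. A word is a
list of pairs `(i, ε)`, standing for the letter `i` if `ε = true` and for its inverse otherwise. -/
def subgroupOfWords {n : ℕ} (W : List (List (Fin n × Bool))) : Subgroup (FreeGroup (Fin n)) :=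
  Subgroup.closure {g | ∃ w ∈ W, FreeGroup.mk w = g}

/-- The list of words as input data for an algorithm: each letter is replaced by its number. -/
def rawWords {n : ℕ} (W : List (List (Fin n × Bool))) : List (List (ℕ × Bool)) :=
  W.map fun w => w.map fun a => ((a.1 : ℕ), a.2)

end ProV

/-!
If `G` is in `H_p` and `H < G`, the functions `G ⧸ H → 𝔽_p` modulo constants form a nonzero
representation of `G`. The normal `p`-subgroup fixes a nonzero vector, and `G` acts on the fixed
vectors through commuting operators `T` with `T ^ p = T`, which have a common eigenvector. For this
eigenfunction `δ`, normalised by `δ H = 0`, we get `δ (g x) = δ (g H) + χ g * δ x` for a character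
`χ`. Hence `G` acts on the line `𝔽_p` by affine maps such that `H` fixes the origin and `G` does
not. Since the affine group of `𝔽_p` is itself in `H_p`, a subgroup `H` of any group `F` is
`H_p`-dense if and only if no affine action of `F` on `𝔽_p` separates it in this way. The affine
actions of a free group of rank `n` are the `n`-tuples of affine maps, so this is a finite search.
-/

namespace ProV

open scoped commutatorElement

section Topology

variable {V : GroupClass.{u}} {F : Type u} [Group F]

theorem isTopologicalBasis_normal_cosets (htop : V (F ⧸ (⊤ : Subgroup F)))
    (hinf : ∀ (K₁ K₂ : Subgroup F) [K₁.Normal] [K₂.Normal],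
      V (F ⧸ K₁) → V (F ⧸ K₂) → V (F ⧸ (K₁ ⊓ K₂))) :
    @TopologicalSpace.IsTopologicalBasis F (proTopology V F)
      {S | ∃ (K : Subgroup F) (_ : K.Normal) (x : F),
        V (F ⧸ K) ∧ S = (fun k => k * x) '' (K : Set F)} := by
  let _ : TopologicalSpace F := proTopology V F
  refine ⟨?_, Set.eq_univ_of_forall fun x => ?_, rfl⟩
  · rintro _ ⟨K₁, _, x₁, hV₁, rfl⟩ _ ⟨K₂, _, x₂, hV₂, rfl⟩ x ⟨⟨k₁, hk₁, rfl⟩, k₂, hk₂, hx⟩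
    refine ⟨_, ⟨K₁ ⊓ K₂, inferInstance, k₁ * x₁, hinf K₁ K₂ hV₁ hV₂, rfl⟩,
      ⟨1, one_mem _, one_mul _⟩, ?_⟩
    rintro _ ⟨k, ⟨hkK₁, hkK₂⟩, rfl⟩
    refine ⟨⟨k * k₁, mul_mem hkK₁ hk₁, mul_assoc _ _ _⟩, k * k₂, mul_mem hkK₂ hk₂, ?_⟩
    simp only [← hx, mul_assoc]
  · exact ⟨_, ⟨⊤, inferInstance, 1, htop, rfl⟩, x, trivial, mul_one x⟩

theorem isDenseIn_iff_sup_eq_top (htop : V (F ⧸ (⊤ : Subgroup F)))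
    (hinf : ∀ (K₁ K₂ : Subgroup F) [K₁.Normal] [K₂.Normal],
      V (F ⧸ K₁) → V (F ⧸ K₂) → V (F ⧸ (K₁ ⊓ K₂))) (H : Subgroup F) :
    IsDenseIn V (H : Set F) ↔ ∀ (K : Subgroup F) [K.Normal], V (F ⧸ K) → K ⊔ H = ⊤ := by
  let _ : TopologicalSpace F := proTopology V F
  refine dense_iff_closure_eq.symm.trans
    ((isTopologicalBasis_normal_cosets htop hinf).dense_iff.trans ⟨fun h K _ hK => ?_, ?_⟩)
  · refine (Subgroup.eq_top_iff' _).2 fun x => ?_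
    obtain ⟨_, ⟨k, hk, rfl⟩, hkH⟩ :=
      h _ ⟨K, inferInstance, x, hK, rfl⟩ ⟨1 * x, 1, one_mem K, rfl⟩
    exact Subgroup.mem_sup_of_normal_left.2 ⟨k⁻¹, inv_mem hk, k * x, hkH, inv_mul_cancel_left k x⟩
  · rintro h _ ⟨K, _, x, hK, rfl⟩ -
    have hx : x ∈ K ⊔ H := h K hK ▸ Subgroup.mem_top x
    obtain ⟨k, hk, y, hy, rfl⟩ := Subgroup.mem_sup_of_normal_left.1 hx
    exact ⟨y, ⟨k⁻¹, inv_mem hk, inv_mul_cancel_left k y⟩, hy⟩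

end Topology

section PByAbelian

/-- The class `G_p * Ab_d` of the extensions of a finite `p`-group by a finite abelian group of
exponent dividing `d`, so that `H_p` is the case `d = p - 1`. -/
def pByAbelian (p d : ℕ) : GroupClass.{u} :=
  product (finPGroups p) (finAbelian d)

variable {p d : ℕ}

theorem pByAbelian_iff {G : Type u} [Group G] :
    pByAbelian p d G ↔ Finite G ∧ ∃ N : Subgroup G, N.Normal ∧ IsPGroup p N ∧
      (∀ x y : G, ⁅x, y⁆ ∈ N) ∧ ∀ x : G, x ^ d ∈ N := by
  constructor
  · rintro ⟨N, _, ⟨_, hN⟩, _, hcomm, hpow⟩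
    refine ⟨Finite.of_subgroup_quotient N, N, inferInstance, hN, fun x y => ?_, fun x => ?_⟩ <;>
      rw [← QuotientGroup.eq_one_iff]
    · exact commutatorElement_eq_one_iff_mul_comm.2 (hcomm x y)
    · exact hpow x
  · rintro ⟨_, N, _, hN, hcomm, hpow⟩
    refine ⟨N, inferInstance, ⟨inferInstance, hN⟩, inferInstance, ?_, ?_⟩
    · rintro ⟨x⟩ ⟨y⟩
      exact commutatorElement_eq_one_iff_mul_comm.1
        ((QuotientGroup.eq_one_iff ⁅x, y⁆).2 (hcomm x y))
    · rintro ⟨x⟩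
      exact (QuotientGroup.eq_one_iff (x ^ d)).2 (hpow x)

theorem pByAbelian.of_injective {G : Type u} {Q : Type*} [Group G] [Group Q] {f : G →* Q}
    (hf : Function.Injective f) (hQ : pByAbelian p d Q) : pByAbelian p d G := by
  obtain ⟨_, N, _, hN, hcomm, hpow⟩ := pByAbelian_iff.1 hQ
  refine pByAbelian_iff.2 ⟨Finite.of_injective f hf, N.comap f, inferInstance,
    hN.comap_of_injective f hf, fun x y => ?_, fun x => ?_⟩
  · simpa only [Subgroup.mem_comap, map_commutatorElement] using hcomm (f x) (f y)
  · simpa only [Subgroup.mem_comap, map_pow] using hpow (f x)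

theorem pByAbelian.prod {G₁ G₂ : Type*} [Group G₁] [Group G₂] (h₁ : pByAbelian p d G₁)
    (h₂ : pByAbelian p d G₂) : pByAbelian p d (G₁ × G₂) := by
  obtain ⟨_, N₁, _, hN₁, hcomm₁, hpow₁⟩ := pByAbelian_iff.1 h₁
  obtain ⟨_, N₂, _, hN₂, hcomm₂, hpow₂⟩ := pByAbelian_iff.1 h₂
  refine pByAbelian_iff.2 ⟨inferInstance, N₁.prod N₂, inferInstance, ?_,
    fun x y => ⟨hcomm₁ x.1 y.1, hcomm₂ x.2 y.2⟩, fun x => ⟨hpow₁ x.1, hpow₂ x.2⟩⟩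
  rintro ⟨⟨x₁, x₂⟩, hx₁, hx₂⟩
  obtain ⟨k₁, hk₁⟩ := hN₁ ⟨x₁, hx₁⟩
  obtain ⟨k₂, hk₂⟩ := hN₂ ⟨x₂, hx₂⟩
  simp only [Subtype.ext_iff, SubmonoidClass.mk_pow, OneMemClass.coe_one] at hk₁ hk₂
  refine ⟨k₁ + k₂, Subtype.ext (Prod.ext ?_ ?_)⟩
  · change x₁ ^ p ^ (k₁ + k₂) = 1
    rw [pow_add, pow_mul, hk₁, one_pow]
  · change x₂ ^ p ^ (k₁ + k₂) = 1
    rw [pow_add, pow_mul', hk₂, one_pow]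

theorem pByAbelian_quotient_top {F : Type u} [Group F] : pByAbelian p d (F ⧸ (⊤ : Subgroup F)) :=
  have := QuotientGroup.subsingleton_quotient_top (G := F)
  pByAbelian_iff.2 ⟨inferInstance, ⊤, inferInstance, .of_subsingleton _ _, fun _ _ => trivial,
    fun _ => trivial⟩

theorem pByAbelian_quotient_inf {F : Type u} [Group F] (K₁ K₂ : Subgroup F) [K₁.Normal]
    [K₂.Normal] (h₁ : pByAbelian p d (F ⧸ K₁)) (h₂ : pByAbelian p d (F ⧸ K₂)) :
    pByAbelian p d (F ⧸ (K₁ ⊓ K₂)) := by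
  let f : F →* (F ⧸ K₁) × (F ⧸ K₂) := (QuotientGroup.mk' K₁).prod (QuotientGroup.mk' K₂)
  have hf : f.ker = K₁ ⊓ K₂ := by
    rw [MonoidHom.ker_prod, QuotientGroup.ker_mk', QuotientGroup.ker_mk']
  have := (h₁.prod h₂).of_injective (QuotientGroup.kerLift_injective f)
  exact this.of_injective (f := (QuotientGroup.quotientMulEquivOfEq hf.symm).toMonoidHom)
    (QuotientGroup.quotientMulEquivOfEq hf.symm).injective

theorem isDenseIn_pByAbelian_iff {F : Type u} [Group F] (H : Subgroup F) :
    IsDenseIn (pByAbelian.{u} p d) (H : Set F) ↔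
      ∀ (K : Subgroup F) [K.Normal], pByAbelian p d (F ⧸ K) → K ⊔ H = ⊤ :=
  isDenseIn_iff_sup_eq_top pByAbelian_quotient_top pByAbelian_quotient_inf H

end PByAbelian

section CommonEigenvector

variable {K V : Type*} [Field K] [AddCommGroup V] [Module K V] [FiniteDimensional K V]
  [Nontrivial V]

theorem exists_hasEigenvalue_of_pow_card_eq_self [Finite K] {f : Module.End K V}
    (hf : f ^ Nat.card K = f) : ∃ a, f.HasEigenvalue a := by
  have hdvd : minpoly K f ∣ Polynomial.X ^ Nat.card K - Polynomial.X :=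
    minpoly.dvd K f (by simp [hf])
  have hsplits : (minpoly K f).Splits := Polynomial.splits_X_pow_nat_card_sub_X.of_dvd
    (FiniteField.X_pow_card_sub_X_ne_zero K Finite.one_lt_card) hdvd
  obtain ⟨a, ha⟩ := hsplits.exists_eval_eq_zero
    (minpoly.degree_pos (Algebra.IsIntegral.isIntegral f)).ne'
  exact ⟨a, Module.End.hasEigenvalue_of_isRoot ha⟩

theorem exists_common_eigenvector_of_pow_card_eq_self [Finite K] {ι : Type*}
    {f : ι → Module.End K V} (hcomm : ∀ i j, Commute (f i) (f j))
    (hf : ∀ i, f i ^ Nat.card K = f i) :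
    ∃ (χ : ι → K) (v : V), v ≠ 0 ∧ ∀ i, f i v = χ i • v := by
  obtain ⟨W, ⟨hW, hinv⟩, hmin⟩ := exists_minimal_of_wellFoundedLT
    (fun W : Submodule K V => W ≠ ⊥ ∧ ∀ i, ∀ w ∈ W, f i w ∈ W) ⟨⊤, top_ne_bot, fun _ _ _ => trivial⟩
  have : Nontrivial W := Submodule.nontrivial_iff_ne_bot.2 hW
  have hscalar : ∀ i, ∃ a : K, ∀ w ∈ W, f i w = a • w := by
    intro i
    obtain ⟨a, ha⟩ := exists_hasEigenvalue_of_pow_card_eq_self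
      (f := (f i).restrict (hinv i)) (by simp_rw [Module.End.pow_restrict _ (hinv i), hf])
    obtain ⟨v, hv⟩ := ha.exists_hasEigenvector
    have hle := hmin (y := W ⊓ (f i).eigenspace a) ⟨(Submodule.ne_bot_iff _).2
      ⟨v, ⟨v.2, Module.End.mem_eigenspace_iff.2 (congrArg Subtype.val hv.apply_eq_smul)⟩,
        Subtype.coe_ne_coe.2 hv.2⟩,
      fun j w hw => ⟨hinv j w hw.1, Module.End.mapsTo_genEigenspace_of_comm (hcomm i j) a 1 hw.2⟩⟩
      inf_le_left
    exact ⟨a, fun w hw => Module.End.mem_eigenspace_iff.1 (hle hw).2⟩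
  choose χ hχ using hscalar
  obtain ⟨v, hvW, hv⟩ := Submodule.exists_mem_ne_zero_of_ne_bot hW
  exact ⟨χ, v, hv, fun i => hχ i v hvW⟩

end CommonEigenvector

section Representation

variable {p : ℕ} [Fact p.Prime] {K V : Type*} [AddCommGroup V]

theorem exists_mem_invariants_ne_zero [Finite V] [Nontrivial V] [CommRing K] [CharP K p]
    [Module K V] {P : Type*} [Group P] (hP : IsPGroup p P) (ρ : Representation K P V) :
    ∃ v ∈ ρ.invariants, v ≠ 0 := by
  let _ : MulAction P V := MulAction.compHom V ρ
  obtain ⟨w, hw⟩ := exists_ne (0 : V)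
  have hpw : p • w = 0 := by rw [← Nat.cast_smul_eq_nsmul K, CharP.cast_eq_zero, zero_smul]
  have hcard : p ∣ Nat.card V := addOrderOf_eq_prime hpw hw ▸ addOrderOf_dvd_natCard w
  obtain ⟨v, hv, hv_ne⟩ := hP.exists_fixed_point_of_prime_dvd_card_of_fixed_point V hcard (a := 0)
    fun g => map_zero (ρ g)
  exact ⟨v, hv, hv_ne.symm⟩

theorem exists_character_of_forall_eq_smul [Field K] [Module K V] {G : Type*} [Group G]
    {ρ : Representation K G V} {v : V} (hv : v ≠ 0) {a : G → K} (ha : ∀ g, ρ g v = a g • v) :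
    ∃ χ : G →* Kˣ, ∀ g, ρ g v = χ g • v := by
  let χ : G →* K :=
    { toFun := a
      map_one' := smul_left_injective K hv (by simp only [← ha, map_one, one_smul,
        Module.End.one_apply])
      map_mul' := fun g h => smul_left_injective K hv (by
        simp only [← ha, map_mul, Module.End.mul_apply, mul_comm (a g), mul_smul]
        rw [ha h, map_smul]) }
  exact ⟨χ.toHomUnits, ha⟩

theorem pByAbelian.exists_eigenvector [Finite V] [Nontrivial V] [Field K] [Finite K] [CharP K p]
    [Module K V] {G : Type*} [Group G] (hG : pByAbelian p (Nat.card K - 1) G)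
    (ρ : Representation K G V) : ∃ (χ : G →* Kˣ) (v : V), v ≠ 0 ∧ ∀ g, ρ g v = χ g • v := by
  obtain ⟨_, N, _, hN, hcomm, hpow⟩ := pByAbelian_iff.1 hG
  let V' := Representation.invariants (ρ.comp N.subtype)
  let σ : Representation K G V' := ρ.toInvariants N
  have hσN : ∀ g ∈ N, σ g = 1 := fun g hg => LinearMap.ext fun v => Subtype.ext (v.2 ⟨g, hg⟩)
  have hσcomm : ∀ g h, Commute (σ g) (σ h) := fun g h => by
    rw [commute_iff_eq, ← map_mul, ← map_mul,
      show g * h = ⁅g, h⁆ * (h * g) by rw [commutatorElement_def]; group, map_mul,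
      hσN _ (hcomm g h), one_mul]
  have hσpow : ∀ g, σ g ^ Nat.card K = σ g := fun g => by
    rw [← pow_sub_one_mul Nat.card_pos.ne', ← map_pow, hσN _ (hpow g), one_mul]
  obtain ⟨v₀, hv₀, hv₀_ne⟩ := exists_mem_invariants_ne_zero hN (ρ.comp N.subtype)
  have : Nontrivial V' := ⟨⟨v₀, hv₀⟩, 0, Subtype.coe_ne_coe.1 hv₀_ne⟩
  obtain ⟨a, v, hv, ha⟩ := exists_common_eigenvector_of_pow_card_eq_self hσcomm hσpow
  obtain ⟨χ, hχ⟩ := exists_character_of_forall_eq_smul hv ha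
  exact ⟨χ, v, Subtype.coe_ne_coe.2 hv, fun g => congrArg Subtype.val (hχ g)⟩

end Representation

section AffineLine

variable {R : Type*} [CommRing R]

/-- The affine self-equivalence `x ↦ b + u * x` of the line. -/
def affineLineEquiv (u : Rˣ) (b : R) : R ≃ᵃ[R] R :=
  (LinearEquiv.smulOfUnit u).toAffineEquiv.trans (AffineEquiv.constVAdd R R b)

theorem affineLineEquiv_apply (u : Rˣ) (b x : R) : affineLineEquiv u b x = b + u * x := rfl

theorem affineLineEquiv_mul (u v : Rˣ) (b c : R) :
    affineLineEquiv u b * affineLineEquiv v c = affineLineEquiv (u * v) (b + u * c) := by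
  ext x
  simp only [AffineEquiv.coe_mul, Function.comp_apply, affineLineEquiv_apply, Units.val_mul]
  ring

/-- The linear part of an affine self-equivalence of the line, as a scalar. -/
noncomputable def slope : (R ≃ᵃ[R] R) →* Rˣ :=
  LinearEquiv.det.comp AffineEquiv.linearHom

theorem affineLineEquiv_slope (e : R ≃ᵃ[R] R) : affineLineEquiv (slope e) (e 0) = e := by
  have hslope : (slope e : R) = e.linear 1 := (LinearEquiv.coe_det _).trans (LinearMap.det_ring _)
  have hlinear (x : R) : e.linear x = slope e * x := by
    rw [hslope, mul_comm, ← smul_eq_mul, ← map_smul, smul_eq_mul, mul_one]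
  ext x
  have hx : e x = e.linear x + e 0 := by simpa using e.map_vadd 0 x
  rw [affineLineEquiv_apply, hx, hlinear, add_comm]

theorem pByAbelian_affineEquiv {K : Type*} [Field K] [Finite K] (p : ℕ) [CharP K p] :
    pByAbelian p (Nat.card K - 1) (K ≃ᵃ[K] K) := by
  have : Finite (K ≃ᵃ[K] K) := DFunLike.finite (K ≃ᵃ[K] K)
  refine pByAbelian_iff.2 ⟨this, (slope (R := K)).ker, inferInstance, ?_,
    fun x y => ?_, fun x => ?_⟩
  · rintro ⟨e, he⟩
    refine ⟨1, Subtype.ext ?_⟩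
    have htrans : e = AffineEquiv.constVAdd K K (e 0) := by
      conv_lhs => rw [← affineLineEquiv_slope e, MonoidHom.mem_ker.1 he]
      ext x
      simp [affineLineEquiv_apply]
    change e ^ p ^ 1 = 1
    rw [htrans, pow_one, ← AffineEquiv.constVAdd_nsmul, ← Nat.cast_smul_eq_nsmul K,
      CharP.cast_eq_zero, zero_smul, AffineEquiv.constVAdd_zero]
    rfl
  · rw [MonoidHom.mem_ker, map_commutatorElement, commutatorElement_eq_one_iff_mul_comm, mul_comm]
  · rw [MonoidHom.mem_ker, map_pow, ← Nat.card_units, pow_card_eq_one']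

end AffineLine

section AffineSeparation

variable {p : ℕ} [Fact p.Prime] {R K : Type*} [CommRing R] [Field K]

variable (R) in
/-- The representation of `G` on the functions on a `G`-set that vanish at a base point `x₀`. They
represent the functions modulo constants. -/
def basedFunctionRep (G : Type*) [Group G] {X : Type*} [MulAction G X] (x₀ : X) :
    Representation R G (LinearMap.ker (LinearMap.proj x₀ : (X → R) →ₗ[R] R)) where
  toFun g :=
    { toFun := fun f => ⟨fun x => f.1 (g⁻¹ • x) - f.1 (g⁻¹ • x₀), sub_self _⟩
      map_add' := fun f₁ f₂ => Subtype.ext <| funext fun x => add_sub_add_comm _ _ _ _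
      map_smul' := fun a f => Subtype.ext <| funext fun x => (mul_sub _ _ _).symm }
  map_one' := by
    ext f x
    have hf : f.1 x₀ = 0 := f.2
    simp [hf]
  map_mul' g h := by
    ext f x
    simp [mul_smul]

instance nontrivial_ker_proj [Nontrivial R] {X : Type*} [Nontrivial X] (x₀ : X) :
    Nontrivial (LinearMap.ker (LinearMap.proj x₀ : (X → R) →ₗ[R] R)) := by
  classical
  obtain ⟨x, hx⟩ := exists_ne x₀
  refine ⟨⟨Pi.single x 1, ?_⟩, 0, fun h => one_ne_zero (α := R) ?_⟩
  · exact Pi.single_eq_of_ne hx.symm 1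
  · simpa using congrFun (congrArg Subtype.val h) x

theorem pByAbelian.exists_equivariant [Finite K] [CharP K p] {G X : Type*} [Group G]
    [MulAction G X] [Finite X] [Nontrivial X] (hG : pByAbelian p (Nat.card K - 1) G) (x₀ : X) :
    ∃ (φ : G →* (K ≃ᵃ[K] K)) (δ : X → K), δ x₀ = 0 ∧ δ ≠ 0 ∧ ∀ g x, δ (g • x) = φ g (δ x) := by
  obtain ⟨χ, ⟨δ, hδ⟩, hδ_ne, hχ⟩ := hG.exists_eigenvector (basedFunctionRep K G x₀)
  have hequiv : ∀ g x, δ (g • x) = δ (g • x₀) + χ⁻¹ g * δ x := fun g x => by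
    have h : δ (g⁻¹⁻¹ • x) - δ (g⁻¹⁻¹ • x₀) = χ g⁻¹ * δ x :=
      congrFun (congrArg Subtype.val (hχ g⁻¹)) x
    rwa [inv_inv, sub_eq_iff_eq_add', map_inv, ← MonoidHom.inv_apply] at h
  let φ : G →* (K ≃ᵃ[K] K) := MonoidHom.mk' (fun g => affineLineEquiv (χ⁻¹ g) (δ (g • x₀)))
    fun g h => by rw [affineLineEquiv_mul, ← map_mul, mul_smul, ← hequiv]
  exact ⟨φ, δ, hδ, fun h => hδ_ne (Subtype.ext h), hequiv⟩

/-- The stabilizer of the origin in an affine action of `G` on the line over `R`. -/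
def originStabilizer {G : Type*} [Group G] (φ : G →* (R ≃ᵃ[R] R)) : Subgroup G where
  carrier := {g | φ g 0 = 0}
  one_mem' := by simp
  mul_mem' {g h} (hg : φ g 0 = 0) (hh : φ h 0 = 0) := by simp [hg, hh]
  inv_mem' {g} (hg : φ g 0 = 0) := by
    simp [AffineEquiv.inv_def, AffineEquiv.symm_apply_eq, hg]

variable (R) in
/-- A subgroup `H` of `G` is affinely separated over `R` if it fixes the origin in some affine
action of `G` on the line over `R` in which `G` moves the origin. -/
def IsAffinelySeparated {G : Type*} [Group G] (H : Subgroup G) : Prop :=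
  ∃ φ : G →* (R ≃ᵃ[R] R), H ≤ originStabilizer φ ∧ originStabilizer φ ≠ ⊤

theorem pByAbelian.isAffinelySeparated [Finite K] [CharP K p] {G : Type*} [Group G]
    (hG : pByAbelian p (Nat.card K - 1) G) {H : Subgroup G} (hH : H ≠ ⊤) :
    IsAffinelySeparated K H := by
  have : Finite G := (pByAbelian_iff.1 hG).1
  have : Nontrivial (G ⧸ H) := QuotientGroup.nontrivial_iff.2 hH
  let x₀ : G ⧸ H := (1 : G)
  have hx₀ : ∀ g : G, g • x₀ = (g : G ⧸ H) := fun g => congrArg _ (mul_one g)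
  obtain ⟨φ, δ, hδ, hδ_ne, hφ⟩ := hG.exists_equivariant (K := K) x₀
  have hφ_zero : ∀ g, φ g 0 = δ g := fun g => by rw [← hδ, ← hφ, hx₀]
  refine ⟨φ, fun h hh => ?_, fun htop => hδ_ne (funext fun x => ?_)⟩
  · change φ h 0 = 0
    rw [hφ_zero, ← hδ, (QuotientGroup.eq (a := h) (b := 1)).2 (by simpa using hh)]
  · obtain ⟨g, rfl⟩ := QuotientGroup.mk_surjective x
    exact hφ_zero g ▸ htop.ge (Subgroup.mem_top g)

variable (K) in
theorem isDenseIn_pByAbelian_iff_not_isAffinelySeparated [Finite K] [CharP K p] {F : Type u}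
    [Group F] (H : Subgroup F) :
    IsDenseIn (pByAbelian.{u} p (Nat.card K - 1)) (H : Set F) ↔ ¬ IsAffinelySeparated K H := by
  rw [isDenseIn_pByAbelian_iff]
  constructor
  · rintro hdense ⟨φ, hH, htop⟩
    have hker : φ.ker ≤ originStabilizer φ := fun g (hg : φ g = 1) => by
      simp [originStabilizer, hg]
    have hquot : pByAbelian p (Nat.card K - 1) (F ⧸ φ.ker) :=
      (pByAbelian_affineEquiv p).of_injective (QuotientGroup.kerLift_injective φ)
    exact htop (top_le_iff.1 (hdense φ.ker hquot ▸ sup_le hker hH))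
  · intro hsep N _ hN
    by_contra hne
    let π := QuotientGroup.mk' N
    have hmap : H.map π ≠ ⊤ := fun h => hne <| by
      rw [sup_comm, ← QuotientGroup.ker_mk' N, ← Subgroup.comap_map_eq, h, Subgroup.comap_top]
    obtain ⟨φ, hH, htop⟩ := hN.isAffinelySeparated (K := K) hmap
    exact hsep ⟨φ.comp π, Subgroup.map_le_iff_le_comap.1 hH, fun h => htop <|
      Subgroup.comap_injective (QuotientGroup.mk'_surjective N) <|
        h.trans (Subgroup.comap_top π).symm⟩

theorem isDenseIn_classH_iff_not_isAffinelySeparated {F : Type u} [Group F] (H : Subgroup F) :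
    IsDenseIn (classH.{u} p) (H : Set F) ↔ ¬ IsAffinelySeparated (ZMod p) H := by
  have h := isDenseIn_pByAbelian_iff_not_isAffinelySeparated (p := p) (ZMod p) H
  rwa [Nat.card_zmod] at h

theorem isAffinelySeparated_closure_iff {α : Type*} (S : Set (FreeGroup α)) :
    IsAffinelySeparated R (Subgroup.closure S) ↔
      ∃ a : α → (R ≃ᵃ[R] R), (∀ g ∈ S, FreeGroup.lift a g 0 = 0) ∧ ∃ i, a i 0 ≠ 0 := by
  have hrange : Subgroup.closure (Set.range (FreeGroup.of (α := α))) = ⊤ :=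
    FreeGroup.closure_range_of α
  have hmoved (a : α → (R ≃ᵃ[R] R)) :
      originStabilizer (FreeGroup.lift a) ≠ ⊤ ↔ ∃ i, a i 0 ≠ 0 := by
    rw [Ne, ← top_le_iff, ← hrange, Subgroup.closure_le, Set.range_subset_iff, not_forall]
    simp [originStabilizer]
  rw [IsAffinelySeparated, FreeGroup.lift.surjective.exists]
  simp only [Subgroup.closure_le, hmoved]
  rfl

end AffineSeparation

section Encoding

/-- The base `p` digit of `c` of index `i`, counted from the least significant one. -/
def digit (p c i : ℕ) : ℕ := c / p ^ i % p

/-- The value at `x` of the letter `a.1`, or of its inverse, when the letter `i` acts by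
`x ↦ digit p d i + digit p c i * x` modulo `p`. The inverse is obtained from `u ^ (p - 2) = u⁻¹`
and `p - b = -b`. -/
def evalLetter (p c d : ℕ) (a : ℕ × Bool) (x : ℕ) : ℕ :=
  if a.2 = true then digit p d a.1 + digit p c a.1 * x
  else digit p c a.1 ^ (p - 2) * (x + (p - digit p d a.1))

/-- The image of the origin under a word whose letters act as in `evalLetter`. -/
def evalWord (p c d : ℕ) (w : List (ℕ × Bool)) : ℕ :=
  w.foldr (evalLetter p c d) 0

/-- The numbers `c` and `d` encode the affine maps `a i` on `ZMod p`: their base `p` digits are the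
slopes and the constant terms. -/
def Encodes {p n : ℕ} (c d : ℕ) (a : Fin n → (ZMod p ≃ᵃ[ZMod p] ZMod p)) : Prop :=
  ∀ i x, a i x = digit p d i + digit p c i * x

/-- The digits of `c` and `d` define an affine action of the free group of rank `n` on `ZMod p` in
which the words of `W` fix the origin and some letter moves it. -/
def IsAffineWitness (p n : ℕ) (W : List (List (ℕ × Bool))) (c d : ℕ) : Prop :=
  (∀ i < n, digit p c i ≠ 0) ∧ (∀ w ∈ W, evalWord p c d w % p = 0) ∧ ∃ i < n, digit p d i ≠ 0

/-- Some pair of numbers is an affine witness. The bound `p ^ n` leaves room for one digit per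
letter and makes the search finite. -/
def HasAffineWitness (p n : ℕ) (W : List (List (ℕ × Bool))) : Prop :=
  ∃ c < p ^ n, ∃ d < p ^ n, IsAffineWitness p n W c d

variable {p n : ℕ} {c d : ℕ} {a : Fin n → (ZMod p ≃ᵃ[ZMod p] ZMod p)}

theorem exists_digit_eq [NeZero p] (f : Fin n → ZMod p) :
    ∃ c < p ^ n, ∀ i : Fin n, (digit p c i : ZMod p) = f i := by
  let e : Fin n → Fin p := fun i => ⟨(f i).val, ZMod.val_lt _⟩
  refine ⟨finFunctionFinEquiv e, (finFunctionFinEquiv e).2, fun i => ?_⟩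
  rw [digit, ← finFunctionFinEquiv_symm_apply_val, Equiv.symm_apply_apply]
  exact ZMod.natCast_zmod_val (f i)

theorem cast_digit_eq_zero_iff (p c i : ℕ) : (digit p c i : ZMod p) = 0 ↔ digit p c i = 0 := by
  rw [ZMod.natCast_eq_zero_iff, Nat.dvd_iff_mod_eq_zero, digit, Nat.mod_mod]

theorem exists_encodes [NeZero p] (a : Fin n → (ZMod p ≃ᵃ[ZMod p] ZMod p)) :
    ∃ c < p ^ n, ∃ d < p ^ n, Encodes c d a := by
  obtain ⟨c, hc, hca⟩ := exists_digit_eq fun i => (slope (a i) : ZMod p)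
  obtain ⟨d, hd, hda⟩ := exists_digit_eq fun i => a i 0
  refine ⟨c, hc, d, hd, fun i x => ?_⟩
  rw [hca, hda, ← affineLineEquiv_apply, affineLineEquiv_slope]

theorem exists_encodes_of_digit_ne_zero [Fact p.Prime] (hc : ∀ i < n, digit p c i ≠ 0) (d : ℕ) :
    ∃ a : Fin n → (ZMod p ≃ᵃ[ZMod p] ZMod p), Encodes c d a :=
  ⟨fun i => affineLineEquiv
    (Units.mk0 (digit p c i : ZMod p) ((cast_digit_eq_zero_iff p c i).not.2 (hc i i.2)))
      (digit p d i), fun _ _ => rfl⟩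

namespace Encodes

theorem digit_ne_zero_iff (h : Encodes c d a) (i : Fin n) : digit p d i ≠ 0 ↔ a i 0 ≠ 0 := by
  rw [h, mul_zero, add_zero, Ne, Ne, cast_digit_eq_zero_iff]

theorem digit_ne_zero [Fact p.Prime] (h : Encodes c d a) (i : Fin n) : digit p c i ≠ 0 := by
  rw [Ne, ← cast_digit_eq_zero_iff]
  intro hi
  refine zero_ne_one ((a i).injective ?_)
  rw [h, h, hi, zero_mul, zero_mul]

theorem cast_evalLetter [Fact p.Prime] (h : Encodes c d a) (i : Fin n) (ε : Bool) (x : ℕ) :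
    (evalLetter p c d (i, ε) x : ZMod p) = (cond ε (a i) (a i)⁻¹) (x : ZMod p) := by
  have hp : p.Prime := Fact.out
  cases ε with
  | true => simp [evalLetter, h i]
  | false =>
    have hu : (digit p c i : ZMod p) ≠ 0 := (cast_digit_eq_zero_iff p c i).not.2 (h.digit_ne_zero i)
    have hinv : (digit p c i : ZMod p) * digit p c i ^ (p - 2) = 1 := by
      rw [← pow_succ', show p - 2 + 1 = p - 1 by have := hp.two_le; omega,
        ZMod.pow_card_sub_one_eq_one hu]
    have hle : digit p d i ≤ p := (Nat.mod_lt _ hp.pos).le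
    simp only [evalLetter, Bool.false_eq_true, if_false, cond_false]
    rw [AffineEquiv.inv_def, eq_comm, AffineEquiv.symm_apply_eq, h, Nat.cast_mul, Nat.cast_pow,
      ← mul_assoc, hinv, Nat.cast_add, Nat.cast_sub hle, ZMod.natCast_self]
    ring

theorem cast_evalWord [Fact p.Prime] (h : Encodes c d a) (w : List (Fin n × Bool)) :
    (evalWord p c d (w.map fun l => ((l.1 : ℕ), l.2)) : ZMod p) =
      FreeGroup.lift a (FreeGroup.mk w) 0 := by
  rw [FreeGroup.lift_mk]
  induction w with
  | nil => simp [evalWord]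
  | cons l w ih =>
    rw [List.map_cons, List.map_cons, List.prod_cons, AffineEquiv.coe_mul, Function.comp_apply,
      ← ih]
    exact h.cast_evalLetter l.1 l.2 _

theorem isAffineWitness_rawWords_iff [Fact p.Prime] (h : Encodes c d a)
    (W : List (List (Fin n × Bool))) :
    IsAffineWitness p n (rawWords W) c d ↔
      (∀ w ∈ W, FreeGroup.lift a (FreeGroup.mk w) 0 = 0) ∧ ∃ i, a i 0 ≠ 0 := by
  have hc : ∀ i < n, digit p c i ≠ 0 := fun i hi => h.digit_ne_zero ⟨i, hi⟩
  have hwords : (∀ w ∈ rawWords W, evalWord p c d w % p = 0) ↔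
      ∀ w ∈ W, FreeGroup.lift a (FreeGroup.mk w) 0 = 0 := by
    simp only [rawWords, List.forall_mem_map, ← Nat.dvd_iff_mod_eq_zero,
      ← ZMod.natCast_eq_zero_iff, h.cast_evalWord]
  have hmoved : (∃ i < n, digit p d i ≠ 0) ↔ ∃ i, a i 0 ≠ 0 := by
    simp only [← h.digit_ne_zero_iff, Fin.exists_iff, exists_prop]
  rw [IsAffineWitness, hwords, hmoved, and_iff_right hc]

end Encodes

theorem hasAffineWitness_rawWords_iff [Fact p.Prime] (W : List (List (Fin n × Bool))) :
    HasAffineWitness p n (rawWords W) ↔ IsAffinelySeparated (ZMod p) (subgroupOfWords W) := by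
  rw [subgroupOfWords, isAffinelySeparated_closure_iff]
  constructor
  · rintro ⟨c, -, d, -, hcd⟩
    obtain ⟨a, h⟩ := exists_encodes_of_digit_ne_zero hcd.1 d
    obtain ⟨hW, hmoved⟩ := (h.isAffineWitness_rawWords_iff W).1 hcd
    exact ⟨a, by rintro _ ⟨w, hw, rfl⟩; exact hW w hw, hmoved⟩
  · rintro ⟨a, hW, hmoved⟩
    obtain ⟨c, hc, d, hd, h⟩ := exists_encodes a
    exact ⟨c, hc, d, hd, (h.isAffineWitness_rawWords_iff W).2
      ⟨fun w hw => hW _ ⟨w, hw, rfl⟩, hmoved⟩⟩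

end Encoding

section Computability

variable {α : Type*} [Primcodable α]

theorem primrec₂_pow : Primrec₂ ((· ^ ·) : ℕ → ℕ → ℕ) :=
  Primrec₂.unpaired'.1 Nat.Primrec.pow

theorem primrecPred_exists_lt {f : α → ℕ} {R : ℕ → α → Prop} (hf : Primrec f)
    (hR : PrimrecRel R) : PrimrecPred fun a => ∃ x < f a, R x a :=
  (hR.exists_mem_list.comp (Primrec.list_range.comp hf) Primrec.id).of_eq (by simp)

theorem primrecPred_forall_lt {f : α → ℕ} {R : ℕ → α → Prop} (hf : Primrec f)
    (hR : PrimrecRel R) : PrimrecPred fun a => ∀ x < f a, R x a :=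
  (hR.forall_mem_list.comp (Primrec.list_range.comp hf) Primrec.id).of_eq (by simp)

variable {p n c d : α → ℕ} (hp : Primrec p) (hn : Primrec n) (hc : Primrec c) (hd : Primrec d)

include hp hc

theorem primrec_digit {i : α → ℕ} (hi : Primrec i) :
    Primrec fun a => digit (p a) (c a) (i a) :=
  Primrec.nat_mod.comp (Primrec.nat_div.comp hc (primrec₂_pow.comp hp hi)) hp

theorem primrecRel_digit_ne_zero : PrimrecRel fun i a => digit (p a) (c a) i ≠ 0 :=
  (Primrec.eq.comp (primrec_digit (hp.comp Primrec.snd) (hc.comp Primrec.snd) Primrec.fst)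
    (Primrec.const 0)).not

include hd

theorem primrec_evalLetter {l : α → ℕ × Bool} {x : α → ℕ} (hl : Primrec l) (hx : Primrec x) :
    Primrec fun a => evalLetter (p a) (c a) (d a) (l a) (x a) := by
  have hu := primrec_digit hp hc (Primrec.fst.comp hl)
  have hb := primrec_digit hp hd (Primrec.fst.comp hl)
  exact Primrec.ite (Primrec.eq.comp (Primrec.snd.comp hl) (Primrec.const true))
    (Primrec.nat_add.comp hb (Primrec.nat_mul.comp hu hx))
    (Primrec.nat_mul.comp (primrec₂_pow.comp hu (Primrec.nat_sub.comp hp (Primrec.const 2)))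
      (Primrec.nat_add.comp hx (Primrec.nat_sub.comp hp hb)))

theorem primrec_evalWord {w : α → List (ℕ × Bool)} (hw : Primrec w) :
    Primrec fun a => evalWord (p a) (c a) (d a) (w a) :=
  Primrec.list_foldr hw (Primrec.const 0)
    (h := fun a q => evalLetter (p a) (c a) (d a) q.1 q.2)
    (primrec_evalLetter (hp.comp Primrec.fst) (hc.comp Primrec.fst) (hd.comp Primrec.fst)
      (Primrec.fst.comp Primrec.snd) (Primrec.snd.comp Primrec.snd))

include hn

theorem primrecPred_isAffineWitness {W : α → List (List (ℕ × Bool))} (hW : Primrec W) :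
    PrimrecPred fun a => IsAffineWitness (p a) (n a) (W a) (c a) (d a) := by
  have hfixed : PrimrecRel fun w a => evalWord (p a) (c a) (d a) w % p a = 0 :=
    Primrec.eq.comp (Primrec.nat_mod.comp (primrec_evalWord (hp.comp Primrec.snd)
      (hc.comp Primrec.snd) (hd.comp Primrec.snd) Primrec.fst) (hp.comp Primrec.snd))
      (Primrec.const 0)
  exact (primrecPred_forall_lt hn (primrecRel_digit_ne_zero hp hc)).and
    ((hfixed.forall_mem_list.comp hW Primrec.id).and
      (primrecPred_exists_lt hn (primrecRel_digit_ne_zero hp hd)))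

end Computability

theorem primrecPred_hasAffineWitness :
    PrimrecPred fun q : ℕ × ℕ × List (List (ℕ × Bool)) => HasAffineWitness q.1 q.2.1 q.2.2 := by
  have hbound : Primrec fun q : ℕ × ℕ × List (List (ℕ × Bool)) => q.1 ^ q.2.1 :=
    primrec₂_pow.comp Primrec.fst (Primrec.fst.comp Primrec.snd)
  have hq : Primrec fun r : ℕ × ℕ × ℕ × ℕ × List (List (ℕ × Bool)) => r.2.2 :=
    Primrec.snd.comp Primrec.snd
  exact primrecPred_exists_lt hbound <| primrecPred_exists_lt (hbound.comp Primrec.snd) <|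
    primrecPred_isAffineWitness (Primrec.fst.comp hq) (Primrec.fst.comp (Primrec.snd.comp hq))
      (Primrec.fst.comp Primrec.snd) Primrec.fst (Primrec.snd.comp (Primrec.snd.comp hq))

end ProV

theorem mainTheorem6 :
    ∃ decide : ℕ × ℕ × List (List (ℕ × Bool)) → Bool,
      Computable decide ∧
        ∀ (p n : ℕ) (W : List (List (Fin n × Bool))), p.Prime →
          (decide (p, n, ProV.rawWords W) = true ↔
            ProV.IsDenseIn (ProV.classH p)
              (ProV.subgroupOfWords W : Set (FreeGroup (Fin n)))) := by
  classical
  refine ⟨fun q => decide ¬ ProV.HasAffineWitness q.1 q.2.1 q.2.2,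
    ProV.primrecPred_hasAffineWitness.not.decide.to_comp, fun p n W hp => ?_⟩
  have : Fact p.Prime := ⟨hp⟩
  rw [decide_eq_true_iff, ProV.hasAffineWitness_rawWords_iff,
    ProV.isDenseIn_classH_iff_not_isAffinelySeparated]
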